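/- A \emph{measure on the binary tree} is a function $P:\{0,1\}^*\to\mathbb{Q}_{\ge 0}$ with $P(\text{empty word})=1$ and $P(x0)+P(x1)=P(x)$ for every string $x$; it is \emph{computable} if some algorithm outputs $P(x)$ on every input $x$. Write $P(b\mid x)=P(xb)/P(x)$. A sequence $\omega\in\{0,1\}^{\mathbb N}$ is \emph{Martin-Löf random with respect to $P$} if it does not belong to $\bigcap_n U_n$ for any uniformly computably enumerable sequence of open sets $U_n\subseteq\{0,1\}^{\mathbb N}$ with $P(U_n)\le 2^{-n}$ for all $n$. Fix an optimal prefix-free machine $U$, and for a computable measure $Q$ let $K(Q)$ be its prefix complexity, i.e. the length of a shortest $U$-description of a program that computes $Q$. For every string $x$ let $Q_x$ be a best explanation for $x$, i.e. a computable measure that minimizes \[ 3K(Q)-\log_2 Q(x) \] over all computable measures $Q$ (where $-\log_2 0=+\infty$; if there are several minimizers, any one of them is chosen), and let $H(b\mid x)=Q_x(xb)/Q_x(x)$. Theorem. Let $P$ be a computable measure and let $\omega$ be a Martin-Löf random sequence with respect to $P$. Then $P(x)>0$ and $Q_x(x)>0$ for every prefix $x$ of $\omega$ (so that the ratios below are defined),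 and \[ H(0\mid x)-P(0\mid x)\to 0 \] for prefixes $x$ of $\omega$ as the length of the prefix goes to infinity. -/

import Mathlib

open Filter Topology

/-! ### Computable measures on the binary tree

Bits are Booleans (`false` is the bit 0, `true` is the bit 1), finite strings are lists of bits,
and infinite sequences are functions `ℕ → Bool`. -/

/-- A (rational-valued) probability measure on the binary tree. -/
structure IsTreeMeasure (P : List Bool → ℚ) : Prop where
  nonneg : ∀ x, 0 ≤ P x
  root : P [] = 1
  split : ∀ x, P (x ++ [false]) + P (x ++ [true]) = P x

/-- The program `c` computes the non-negative rational function `P`: on every input string `x` it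
halts and outputs the rational number `P x`, written as (numerator, denominator) in lowest terms. -/
def Computes (c : Nat.Partrec.Code) (P : List Bool → ℚ) : Prop :=
  ∀ x : List Bool,
    c.eval (Encodable.encode x) = Part.some (Nat.pair (P x).num.toNat (P x).den)

/-- A computable measure on the binary tree. -/
structure IsComputableMeasure (P : List Bool → ℚ) : Prop where
  isTreeMeasure : IsTreeMeasure P
  exists_program : ∃ c, Computes c P

/-- The conditional probability `P (b | x) = P (x b) / P x` that the bit after `x` is `b`. -/
def condProb (P : List Bool → ℚ) (b : Bool) (x : List Bool) : ℚ :=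
  P (x ++ [b]) / P x

/-! ### Martin-Löf randomness -/

/-- The prefix of length `n` of an infinite sequence. -/
def seqPrefix (ω : ℕ → Bool) (n : ℕ) : List Bool :=
  (List.range n).map ω

/-- The set of all infinite sequences that have `x` as a prefix. -/
def cylinderOf (x : List Bool) : Set (ℕ → Bool) :=
  {ω | seqPrefix ω x.length = x}

/-- The (outer) measure on the Cantor space determined by `P`: the infimum of the total
`P`-weight over all covers by (necessarily countably many) cylinders. On Borel sets, in particular
on open sets, this is the value of the unique Borel measure that gives each cylinder `cylinderOf x`
the measure `P x`. -/
noncomputable def cantorMeasure (P : List Bool → ℚ) (A : Set (ℕ → Bool)) : ENNReal :=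
  ⨅ (T : Set (List Bool)) (_ : A ⊆ ⋃ x ∈ T, cylinderOf x), ∑' x : T, ENNReal.ofReal (P x : ℝ)

/-- The `n`-th open set described by a set of pairs (level, string). -/
def testLevel (S : Set (ℕ × List Bool)) (n : ℕ) : Set (ℕ → Bool) :=
  ⋃ x ∈ {x : List Bool | (n, x) ∈ S}, cylinderOf x

/-- A Martin-Löf test with respect to `P`: a uniformly computably enumerable sequence of open sets,
the `n`-th of which has `P`-measure at most `2 ^ (-n)`. -/
structure IsMartinLofTest (P : List Bool → ℚ) (S : Set (ℕ × List Bool)) : Prop where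
  enumerable : REPred (fun a : ℕ × List Bool => a ∈ S)
  measure_le : ∀ n, cantorMeasure P (testLevel S n) ≤ (2⁻¹ : ENNReal) ^ n

/-- `ω` is Martin-Löf random with respect to `P`: it passes all Martin-Löf tests. -/
def IsMartinLofRandom (P : List Bool → ℚ) (ω : ℕ → Bool) : Prop :=
  ∀ S, IsMartinLofTest P S → ω ∉ ⋂ n, testLevel S n

/-! ### Prefix complexity of measures -/

/-- A prefix-free machine (decompressor): a partial computable function on strings, no two distinct
elements of whose domain are prefixes of each other. -/
structure IsPrefixMachine (U : List Bool →. ℕ) : Prop where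
  partrec : Partrec U
  prefixFree : ∀ p q, (U p).Dom → (U q).Dom → p <+: q → p = q

/-- An optimal prefix-free machine: its descriptions are, up to an additive constant, at most as
long as those of any other prefix-free machine. -/
structure IsOptimalPrefixMachine (U : List Bool →. ℕ) : Prop where
  isPrefixMachine : IsPrefixMachine U
  optimal : ∀ V, IsPrefixMachine V →
    ∃ d : ℕ, ∀ p n, n ∈ V p → ∃ q : List Bool, n ∈ U q ∧ q.length ≤ p.length + d

/-- The prefix complexity `K(Q)` of a computable measure `Q` with respect to the machine `U`: the
least length of a `U`-description of (the number of) a program that computes `Q`. -/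
noncomputable def measureComplexity (U : List Bool →. ℕ) (Q : List Bool → ℚ) : ℕ :=
  sInf {k | ∃ (p : List Bool) (c : Nat.Partrec.Code),
    Computes c Q ∧ Encodable.encode c ∈ U p ∧ p.length = k}

/-! ### Best explanations -/

/-- The quality `3 K(Q) - log₂ Q(x)` of `Q` as an explanation for `x`
(equal to `+∞` if `Q x = 0`). -/
noncomputable def explanationCost (U : List Bool →. ℕ) (Q : List Bool → ℚ) (x : List Bool) :
    EReal :=
  if Q x = 0 then ⊤ else ((3 * (measureComplexity U Q : ℝ) - Real.logb 2 (Q x : ℝ) : ℝ) : EReal)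

/-- `Q` is a best explanation for `x`: a computable measure for which `3 K(Q) - log₂ Q(x)` is
minimal among all computable measures. -/
structure IsBestExplanation (U : List Bool →. ℕ) (x : List Bool) (Q : List Bool → ℚ) : Prop where
  isComputableMeasure : IsComputableMeasure Q
  minimal : ∀ Q', IsComputableMeasure Q' → explanationCost U Q x ≤ explanationCost U Q' x

/-- The prediction `H (b | x) = Q (x b) / Q x`, where `Q = best x` is the explanation selected
for `x`. -/
def bestPrediction (best : List Bool → List Bool → ℚ) (b : Bool) (x : List Bool) : ℚ :=
  condProb (best x) b x

/-!
Along a random sequence only finitely many measures occur as best explanations, and each of these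
finitely many measures predicts asymptotically like `P`.

*Finiteness.* The mixture `∑ 2 ^ (-|p|) Q_p`, taken over all descriptions `p` of programs `Q_p`, is a
lower semicomputable superadditive weight, once every program is cut off where it stops behaving
like a measure. By Ville's inequality (`IsSuperadditive.cantorMeasure_le`) the strings on which one of
its terms reaches `2 ^ n P` form a Martin-Löf test. Hence along a random sequence `P x > 0` and
`Q x < 2 ^ (n + K(Q)) P x` for a constant `n` and all computable measures `Q`
(`IsMartinLofRandom.exists_lt`). A best explanation `Q` for `x` satisfies
`Q x ≥ 2 ^ (3 K(Q) - 3 K(P)) P x` (`IsBestExplanation.pos_and_le`). The two inequalities bound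
`K(Q)`, and they keep the ratio `Q x / P x` between two positive constants.

*Merging.* For fixed `Q`, the function `P Q / (P + Q)` is superadditive since `p q / (p + q)` is
concave, and its loss at `x` is at least `(P x + Q x) / m ^ 2` whenever
`m |Q(x0) P(x) - P(x0) Q(x)| > (P x + Q x) ^ 2` (`mul_div_add_split_le`). The loss therefore pays for
the number of such disagreements, and Ville's inequality turns the strings with many disagreements
into a test: a random sequence has finitely many of them
(`IsMartinLofRandom.eventually_not_disagree`). As long as `Q x / P x` is bounded away from `0` and
from infinity, the absence of a disagreement means that the conditional probabilities differ by
`O(1 / m)`.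
-/

/-! ### Computable functions and recursively enumerable predicates -/

theorem Computable.nat_mul {α : Type*} [Primcodable α] {f g : α → ℕ} (hf : Computable f)
    (hg : Computable g) : Computable fun a => f a * g a :=
  Primrec.nat_mul.to_comp.comp hf hg

theorem Computable.nat_add {α : Type*} [Primcodable α] {f g : α → ℕ} (hf : Computable f)
    (hg : Computable g) : Computable fun a => f a + g a :=
  Primrec.nat_add.to_comp.comp hf hg

theorem Computable.nat_pow {α : Type*} [Primcodable α] {f g : α → ℕ} (hf : Computable f)
    (hg : Computable g) : Computable fun a => f a ^ g a :=
  (Primrec₂.unpaired'.1 Nat.Primrec.pow).to_comp.comp hf hg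

theorem Computable.nat_sub {α : Type*} [Primcodable α] {f g : α → ℕ} (hf : Computable f)
    (hg : Computable g) : Computable fun a => f a - g a :=
  Primrec.nat_sub.to_comp.comp hf hg

theorem Computable.nat_count {α : Type*} [Primcodable α] {p : α → ℕ → Prop}
    [∀ a, DecidablePred (p a)] {f : α → ℕ}
    (hp : Computable fun a : α × ℕ => decide (p a.1 a.2)) (hf : Computable f) :
    Computable fun a => Nat.count (p a) (f a) := by
  have hs : Computable fun q : α × (ℕ × ℕ) => _root_.cond (decide (p q.1 q.2.1)) (q.2.2 + 1) q.2.2 := by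
    have hn := Computable.snd.comp (Computable.snd (α := α) (β := ℕ × ℕ))
    have hp' := hp.comp (Computable.fst.pair (Computable.fst.comp
      (Computable.snd (α := α) (β := ℕ × ℕ))))
    exact Computable.cond hp' (Computable.succ.comp hn) hn
  refine (Computable.nat_rec hf (Computable.const 0) hs.to₂).of_eq fun a => ?_
  induction f a with
  | zero => simp
  | succ k ih =>
    rw [Nat.count_succ, ← ih]
    by_cases h : p a k <;> simp [h]

theorem REPred.comp {α β : Type*} [Primcodable α] [Primcodable β] {p : β → Prop} {f : α → β}
    (hp : REPred p) (hf : Computable f) : REPred fun a => p (f a) :=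
  Partrec.comp hp hf

theorem REPred.and {α : Type*} [Primcodable α] {p q : α → Prop} (hp : REPred p) (hq : REPred q) :
    REPred fun a => p a ∧ q a := by
  have h : Partrec fun a => (Part.assert (p a) fun _ => Part.some ()).bind
      fun _ => Part.assert (q a) fun _ => Part.some () :=
    Partrec.bind hp (Partrec.comp hq Computable.fst).to₂
  refine h.dom_re.of_eq fun a => ?_
  simp [Part.assert, Part.bind]

theorem REPred.forall_lt {α : Type*} [Primcodable α] {p : α → ℕ → Prop} {f : α → ℕ}
    (hp : REPred fun a : α × ℕ => p a.1 a.2) (hf : Computable f) :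
    REPred fun a => ∀ i < f a, p a i := by
  have h : Partrec fun a => (Nat.rec (Part.some ())
      (fun i IH => IH.bind fun _ => Part.assert (p a i) fun _ => Part.some ()) (f a) :
        Part Unit) :=
    Partrec.nat_rec hf (Partrec.some.comp (Computable.const ()))
      (Partrec.comp hp (Computable.pair Computable.fst
        (Computable.fst.comp Computable.snd))).to₂
  refine h.dom_re.of_eq fun a => ?_
  induction f a with
  | zero => simp
  | succ k ih =>
    rw [Nat.forall_lt_succ_right, ← ih]
    simp [Part.assert, Part.bind]

theorem REPred.exists {α β : Type*} [Primcodable α] [Primcodable β] {p : α → β → Prop}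
    (hp : REPred fun a : α × β => p a.1 a.2) : REPred fun a => ∃ b, p a b := by
  obtain ⟨c, hc⟩ := Nat.Partrec.Code.exists_code.1 hp
  have hdom : ∀ a b, p a b ↔ (c.eval (Encodable.encode (a, b))).Dom := by
    intro a b
    rw [hc]
    simp [Part.assert]
  -- Search simultaneously for the witness `b` and for a time bound for the computation.
  let g : α → ℕ → Option ℕ := fun a n =>
    (Encodable.decode n.unpair.2 : Option β).bind fun b =>
      Nat.Partrec.Code.evaln n.unpair.1 c (Encodable.encode (a, b))
  have hg : Computable₂ g := by
    have h₁ : Computable fun q : (α × ℕ) × β =>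
        ((q.1.2.unpair.1, c), Encodable.encode (q.1.1, q.2)) :=
      Computable.pair (Computable.pair
        (Computable.fst.comp (Computable.unpair.comp (Computable.snd.comp Computable.fst)))
        (Computable.const c))
        (Computable.encode.comp (Computable.pair (Computable.fst.comp Computable.fst)
          Computable.snd))
    have heval := Nat.Partrec.Code.primrec_evaln.to_comp
    have h₂ := heval.comp h₁
    exact Computable.option_bind
      (Computable.decode.comp (Computable.snd.comp (Computable.unpair.comp Computable.snd)))
      h₂.to₂
  refine (Partrec.rfindOpt hg).dom_re.of_eq fun a => ?_
  rw [Nat.rfindOpt_dom]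
  constructor
  · rintro ⟨n, v, hv⟩
    obtain ⟨b, -, hb⟩ := Option.bind_eq_some_iff.1 hv
    exact ⟨b, (hdom a b).2 (Part.dom_iff_mem.2 ⟨v, Nat.Partrec.Code.evaln_sound hb⟩)⟩
  · rintro ⟨b, hb⟩
    obtain ⟨v, hv⟩ := Part.dom_iff_mem.1 ((hdom a b).1 hb)
    obtain ⟨k, hk⟩ := Nat.Partrec.Code.evaln_complete.1 hv
    refine ⟨Nat.pair k (Encodable.encode b), v, ?_⟩
    simp only [g, Nat.unpair_pair, Encodable.encodek]
    exact hk

/-- The graph of a partial recursive function is recursively enumerable. -/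
theorem Partrec.mem_re {α β : Type*} [Primcodable α] [Primcodable β] {f : α →. β}
    (hf : Partrec f) : REPred fun a : α × β => a.2 ∈ f a.1 := by
  classical
  have h : Partrec fun a : α × β => (f a.1).bind fun b =>
      ((if b = a.2 then some () else Option.none : Option Unit) : Part Unit) := by
    have h₁ : Primrec fun q : (α × β) × β => if q.2 = q.1.2 then some () else Option.none :=
      Primrec.ite (Primrec.eq.comp Primrec.snd (Primrec.snd.comp Primrec.fst))
        (Primrec.const _) (Primrec.const _)
    exact Partrec.bind (hf.comp Computable.fst) (Computable.ofOption h₁.to_comp).to₂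
  refine h.dom_re.of_eq fun a => ?_
  rw [Part.dom_iff_mem]
  constructor
  · rintro ⟨u, hu⟩
    obtain ⟨b, hb, hu⟩ := Part.mem_bind_iff.1 hu
    by_cases hba : b = a.2
    · exact hba ▸ hb
    · simp [hba] at hu
  · intro ha
    exact ⟨(), Part.mem_bind_iff.2 ⟨a.2, ha, by simp⟩⟩

theorem Computable.re_le {α : Type*} [Primcodable α] {f g : α → ℕ} (hf : Computable f)
    (hg : Computable g) : REPred fun a => f a ≤ g a := by
  have h : REPred fun p : ℕ × ℕ => p.1 ≤ p.2 :=
    (PrimrecPred.computablePred (Primrec.nat_le.comp Primrec.fst Primrec.snd)).to_re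
  exact h.comp (hf.pair hg)

theorem Computable.re_eq {α : Type*} [Primcodable α] {f g : α → ℕ} (hf : Computable f)
    (hg : Computable g) : REPred fun a => f a = g a := by
  have h : REPred fun p : ℕ × ℕ => p.1 = p.2 :=
    (PrimrecPred.computablePred (Primrec.eq.comp Primrec.fst Primrec.snd)).to_re
  exact h.comp (hf.pair hg)

theorem Computable.re_ne_zero {α : Type*} [Primcodable α] {f : α → ℕ} (hf : Computable f) :
    REPred fun a => f a ≠ 0 :=
  (Computable.re_le (Computable.const 1) hf).of_eq fun _ => Nat.one_le_iff_ne_zero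


/-! ### Superadditive weights: the inequalities of Kraft and Ville -/

/-- A non-negative weight on strings that is superadditive: the weights of the two children of a
node add up to at most the weight of the node. -/
def IsSuperadditive (W : List Bool → ENNReal) : Prop :=
  ∀ x, W (x ++ [false]) + W (x ++ [true]) ≤ W x

theorem IsSuperadditive.sum_le {W : List Bool → ENNReal} (hW : IsSuperadditive W) (L : ℕ)
    (r : List Bool) (F : Finset (List Bool)) (hlen : ∀ x ∈ F, x.length ≤ L)
    (hF : ∀ x ∈ F, ∀ y ∈ F, x <+: y → x = y) : ∑ x ∈ F, W (r ++ x) ≤ W r := by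
  classical
  induction L generalizing r F with
  | zero =>
    have hsub : F ⊆ {[]} := by
      intro x hx
      simpa using hlen x hx
    calc ∑ x ∈ F, W (r ++ x) ≤ ∑ x ∈ {[]}, W (r ++ x) := Finset.sum_le_sum_of_subset hsub
      _ = W r := by simp
  | succ L ih =>
    by_cases hnil : [] ∈ F
    · have hsub : F ⊆ {[]} := by
        intro x hx
        simpa using (hF [] hnil x hx List.nil_prefix).symm
      calc ∑ x ∈ F, W (r ++ x) ≤ ∑ x ∈ {[]}, W (r ++ x) := Finset.sum_le_sum_of_subset hsub
        _ = W r := by simp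
    · let G : Bool → Finset (List Bool) := fun b =>
        F.preimage (List.cons b) (List.cons_injective.injOn)
      have hG : ∀ b, ∑ y ∈ G b, W (r ++ b :: y) ≤ W (r ++ [b]) := by
        intro b
        have := ih (r ++ [b]) (G b)
          (fun y hy => by
            have := hlen _ (Finset.mem_preimage.1 hy)
            simpa using this)
          (fun y hy z hz hyz => by
            have := hF _ (Finset.mem_preimage.1 hy) _ (Finset.mem_preimage.1 hz)
              ((List.prefix_cons_inj b).2 hyz)
            simpa using this)
        simpa using this
      have hsub : F ⊆ (G false).image (List.cons false) ∪ (G true).image (List.cons true) := by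
        intro x hx
        match x with
        | [] => exact absurd hx hnil
        | false :: y => simp [G, hx]
        | true :: y => simp [G, hx]
      calc ∑ x ∈ F, W (r ++ x)
          ≤ ∑ x ∈ (G false).image (List.cons false) ∪ (G true).image (List.cons true),
              W (r ++ x) := Finset.sum_le_sum_of_subset hsub
        _ ≤ ∑ x ∈ (G false).image (List.cons false), W (r ++ x)
            + ∑ x ∈ (G true).image (List.cons true), W (r ++ x) := by
          rw [← Finset.sum_union_inter]
          exact le_self_add
        _ = ∑ y ∈ G false, W (r ++ false :: y) + ∑ y ∈ G true, W (r ++ true :: y) := by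
          rw [Finset.sum_image (List.cons_injective.injOn),
            Finset.sum_image (List.cons_injective.injOn)]
        _ ≤ W (r ++ [false]) + W (r ++ [true]) := add_le_add (hG _) (hG _)
        _ ≤ W r := hW r

/-- Kraft's inequality: a superadditive weight gives a prefix-free set of strings a total weight of
at most the weight of the root. -/
theorem IsSuperadditive.tsum_le {W : List Bool → ENNReal} (hW : IsSuperadditive W)
    (T : Set (List Bool)) (hT : ∀ x ∈ T, ∀ y ∈ T, x <+: y → x = y) :
    ∑' x : T, W x ≤ W [] := by
  classical
  refine ENNReal.summable.tsum_le_of_sum_le fun s => ?_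
  have h := hW.sum_le ((s.map (Function.Embedding.subtype _)).sup List.length) []
    (s.map (Function.Embedding.subtype _)) (fun x hx => Finset.le_sup (f := List.length) hx)
    (fun x hx y hy => by
      simp only [Finset.mem_map, Function.Embedding.subtype_apply] at hx hy
      obtain ⟨x, -, rfl⟩ := hx
      obtain ⟨y, -, rfl⟩ := hy
      exact hT _ x.2 _ y.2)
  simpa using h

theorem length_seqPrefix (ω : ℕ → Bool) (n : ℕ) : (seqPrefix ω n).length = n := by
  simp [seqPrefix]

theorem take_seqPrefix (ω : ℕ → Bool) {i n : ℕ} (h : i ≤ n) :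
    (seqPrefix ω n).take i = seqPrefix ω i := by
  simp [seqPrefix, ← List.map_take, List.take_range, h]

theorem mem_testLevel {S : Set (ℕ × List Bool)} {n : ℕ} {ω : ℕ → Bool} :
    ω ∈ testLevel S n ↔ ∃ k, (n, seqPrefix ω k) ∈ S := by
  simp only [testLevel, cylinderOf, Set.mem_iUnion, Set.mem_ofPred_eq]
  constructor
  · rintro ⟨x, hx, h⟩
    exact ⟨x.length, by rwa [h]⟩
  · rintro ⟨k, hk⟩
    exact ⟨_, hk, by rw [length_seqPrefix]⟩

/-- Ville's inequality: if the superadditive weight `W` starts with at most `1` and is at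
least `2 ^ n * P` on all strings of the `n`-th level of `S`, that level is small with respect to `P`. -/
theorem IsSuperadditive.cantorMeasure_le {W : List Bool → ENNReal} (hW : IsSuperadditive W)
    (hroot : W [] ≤ 1) {P : List Bool → ℚ} {S : Set (ℕ × List Bool)} {n : ℕ}
    (hS : ∀ x, (n, x) ∈ S → 2 ^ n * ENNReal.ofReal (P x : ℝ) ≤ W x) :
    cantorMeasure P (testLevel S n) ≤ (2⁻¹ : ENNReal) ^ n := by
  -- The minimal strings of the level form a prefix-free cover of the same open set.
  let T : Set (List Bool) := {x | (n, x) ∈ S ∧ ∀ y, (n, y) ∈ S → y <+: x → y = x}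
  have hcover : testLevel S n ⊆ ⋃ x ∈ T, cylinderOf x := by
    classical
    intro ω hω
    have h := mem_testLevel.1 hω
    refine Set.mem_biUnion (x := seqPrefix ω (Nat.find h)) ⟨Nat.find_spec h, ?_⟩ ?_
    · intro y hy hyx
      have hlen := hyx.length_le
      rw [length_seqPrefix] at hlen
      have hy' : y = seqPrefix ω y.length := by
        rw [← take_seqPrefix ω hlen]
        exact List.prefix_iff_eq_take.1 hyx
      have : Nat.find h ≤ y.length := Nat.find_min' h (hy' ▸ hy)
      rw [hy', le_antisymm hlen this]
    · simp [cylinderOf, length_seqPrefix]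
  calc cantorMeasure P (testLevel S n) ≤ ∑' x : T, ENNReal.ofReal (P x : ℝ) :=
        iInf₂_le T hcover
    _ ≤ ∑' x : T, (2⁻¹ : ENNReal) ^ n * W x := by
        refine ENNReal.tsum_le_tsum fun x => ?_
        calc ENNReal.ofReal (P x : ℝ)
            = (2⁻¹ : ENNReal) ^ n * (2 ^ n * ENNReal.ofReal (P x : ℝ)) := by
              rw [← mul_assoc, ← mul_pow, ENNReal.inv_mul_cancel two_ne_zero ENNReal.ofNat_ne_top,
                one_pow, one_mul]
          _ ≤ _ := mul_le_mul_right (hS x x.2.1) _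
    _ = (2⁻¹ : ENNReal) ^ n * ∑' x : T, W x := ENNReal.tsum_mul_left
    _ ≤ (2⁻¹ : ENNReal) ^ n * 1 :=
        mul_le_mul_right ((hW.tsum_le T fun x hx y hy hxy => hy.2 x hx.1 hxy).trans hroot) _
    _ = _ := mul_one _

/-! ### The universal test -/

section programs

open Nat.Partrec (Code)

/-- The rational number coded by the pair (numerator, denominator). -/
def codedRat (v : ℕ) : ℚ :=
  (v.unpair.1 : ℚ) / (v.unpair.2 : ℚ)

/-- The numbers `v`, `v₀`, `v₁` code fractions with non-zero denominators, the first of which is the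
sum of the other two. -/
def CodedAdd (v v₀ v₁ : ℕ) : Prop :=
  (v.unpair.2 ≠ 0 ∧ v₀.unpair.2 ≠ 0 ∧ v₁.unpair.2 ≠ 0) ∧
    (v₀.unpair.1 * v₁.unpair.2 + v₁.unpair.1 * v₀.unpair.2) * v.unpair.2 =
      v.unpair.1 * (v₀.unpair.2 * v₁.unpair.2)

/-- The program `c` halts on `y` and on both children of `y`, and the three outputs satisfy the
additivity condition of a measure. -/
def SplitsAt (c : Code) (y : List Bool) : Prop :=
  ∃ v v₀ v₁ : ℕ, (v ∈ c.eval (Encodable.encode y) ∧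
    v₀ ∈ c.eval (Encodable.encode (y ++ [false])) ∧
    v₁ ∈ c.eval (Encodable.encode (y ++ [true]))) ∧ CodedAdd v v₀ v₁

/-- The program `c` behaves like a measure along the path from the root to `x`. This is what can be
verified about an arbitrary program when it is used to bound the measure of `x`. -/
def ValidUpTo (c : Code) (x : List Bool) : Prop :=
  (∃ v : ℕ, v ∈ c.eval (Encodable.encode ([] : List Bool)) ∧ v.unpair.1 ≤ v.unpair.2) ∧
    ∀ i < x.length, SplitsAt c (x.take i)

open Classical in
/-- The rational number output by the program `c` on `x` if `c` is valid up to `x`, and `0`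
otherwise. -/
noncomputable def validOutput (c : Code) (x : List Bool) : ENNReal :=
  if h : ValidUpTo c x ∧ (c.eval (Encodable.encode x)).Dom then
    ENNReal.ofReal (codedRat ((c.eval (Encodable.encode x)).get h.2) : ℝ)
  else 0

theorem codedRat_nonneg (v : ℕ) : 0 ≤ codedRat v := by
  unfold codedRat
  positivity

theorem CodedAdd.eq {v v₀ v₁ : ℕ} (h : CodedAdd v v₀ v₁) :
    codedRat v₀ + codedRat v₁ = codedRat v := by
  obtain ⟨⟨h, h₀, h₁⟩, e⟩ := h
  unfold codedRat
  rw [div_add_div _ _ (by exact_mod_cast h₀) (by exact_mod_cast h₁),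
    div_eq_div_iff (by exact_mod_cast mul_ne_zero h₀ h₁) (by exact_mod_cast h)]
  rw [mul_comm _ (v₁.unpair.1 : ℚ)]
  exact_mod_cast e

theorem validUpTo_append {c : Code} {x : List Bool} {b : Bool} :
    ValidUpTo c (x ++ [b]) ↔ ValidUpTo c x ∧ SplitsAt c x := by
  unfold ValidUpTo
  rw [List.length_append, List.length_singleton, Nat.forall_lt_succ_right, and_assoc]
  refine and_congr_right fun _ => and_congr (forall₂_congr fun i hi => ?_) ?_
  · rw [List.take_append_of_le_length hi.le]
  · rw [List.take_left]

theorem validOutput_of_mem {c : Code} {x : List Bool} {v : ℕ} (hx : ValidUpTo c x)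
    (hv : v ∈ c.eval (Encodable.encode x)) :
    validOutput c x = ENNReal.ofReal (codedRat v : ℝ) := by
  rw [validOutput, dif_pos ⟨hx, Part.dom_iff_mem.2 ⟨v, hv⟩⟩, Part.get_eq_of_mem hv]

theorem isSuperadditive_validOutput (c : Code) : IsSuperadditive (validOutput c) := by
  intro x
  by_cases h : ValidUpTo c x ∧ SplitsAt c x
  · obtain ⟨v, v₀, v₁, ⟨hv, hv₀, hv₁⟩, hadd⟩ := h.2
    rw [validOutput_of_mem h.1 hv, validOutput_of_mem (validUpTo_append.2 h) hv₀,
      validOutput_of_mem (validUpTo_append.2 h) hv₁, ← hadd.eq,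
      ← ENNReal.ofReal_add (by exact_mod_cast codedRat_nonneg v₀)
        (by exact_mod_cast codedRat_nonneg v₁)]
    push_cast
    exact le_rfl
  · have h0 : ∀ b, validOutput c (x ++ [b]) = 0 := fun b =>
      dif_neg fun h' => h (validUpTo_append.1 h'.1)
    simp [h0]

theorem validOutput_nil_le (c : Code) : validOutput c [] ≤ 1 := by
  by_cases h : ValidUpTo c []
  · obtain ⟨v, hv, hle⟩ := h.1
    rw [validOutput_of_mem h hv, ENNReal.ofReal_le_one]
    have : codedRat v ≤ 1 := div_le_one_of_le₀ (by exact_mod_cast hle) (Nat.cast_nonneg _)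
    exact_mod_cast this
  · rw [validOutput, dif_neg fun h' => h h'.1]
    exact zero_le_one

theorem codedRat_pair {q : ℚ} (hq : 0 ≤ q) : codedRat (Nat.pair q.num.toNat q.den) = q := by
  have h : ((q.num.toNat : ℕ) : ℚ) = (q.num : ℚ) := by
    exact_mod_cast Int.toNat_of_nonneg (Rat.num_nonneg.2 hq)
  rw [codedRat, Nat.unpair_pair, h, Rat.num_div_den]

theorem Computes.mem {c : Code} {Q : List Bool → ℚ} (h : Computes c Q) (x : List Bool) :
    Nat.pair (Q x).num.toNat (Q x).den ∈ c.eval (Encodable.encode x) := by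
  rw [h x]
  exact Part.mem_some _

theorem Computes.splitsAt {c : Code} {Q : List Bool → ℚ} (h : Computes c Q)
    (hQ : IsTreeMeasure Q) (y : List Bool) : SplitsAt c y := by
  refine ⟨_, _, _, ⟨h.mem y, h.mem _, h.mem _⟩, ?_⟩
  simp only [CodedAdd, Nat.unpair_pair]
  refine ⟨⟨(Q y).den_nz, Rat.den_nz _, Rat.den_nz _⟩, ?_⟩
  have hnum : ∀ x, (((Q x).num.toNat : ℕ) : ℚ) = Q x * (Q x).den := fun x => by
    rw [Rat.mul_den_eq_num]
    exact_mod_cast Int.toNat_of_nonneg (Rat.num_nonneg.2 (hQ.nonneg x))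
  have hs := hQ.split y
  rw [← Nat.cast_inj (R := ℚ)]
  push_cast [hnum]
  linear_combination (Q (y ++ [false])).den * (Q (y ++ [true])).den * (Q y).den * hs

theorem Computes.validUpTo {c : Code} {Q : List Bool → ℚ} (h : Computes c Q)
    (hQ : IsTreeMeasure Q) (x : List Bool) : ValidUpTo c x :=
  ⟨⟨_, h.mem [], by simp [hQ.root]⟩, fun _ _ => h.splitsAt hQ _⟩

theorem computable_codedNum : Computable fun v : ℕ => v.unpair.1 :=
  Computable.fst.comp Computable.unpair

theorem computable_codedDen : Computable fun v : ℕ => v.unpair.2 :=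
  Computable.snd.comp Computable.unpair

theorem Computable.re_mem_eval {α : Type*} [Primcodable α] {f : α → Code} {g : α → List Bool}
    {v : α → ℕ} (hf : Computable f) (hg : Computable g) (hv : Computable v) :
    REPred fun a => v a ∈ (f a).eval (Encodable.encode (g a)) := by
  have h := Partrec.mem_re (f := fun p : Code × ℕ => p.1.eval p.2) Code.eval_part
  exact h.comp ((hf.pair (Computable.encode.comp hg)).pair hv)

theorem re_codedAdd : REPred fun a : ℕ × ℕ × ℕ => CodedAdd a.1 a.2.1 a.2.2 := by
  have hv : Computable fun a : ℕ × ℕ × ℕ => a.1 := Computable.fst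
  have hv₀ : Computable fun a : ℕ × ℕ × ℕ => a.2.1 := Computable.fst.comp Computable.snd
  have hv₁ : Computable fun a : ℕ × ℕ × ℕ => a.2.2 := Computable.snd.comp Computable.snd
  have n := computable_codedNum.comp hv
  have n₀ := computable_codedNum.comp hv₀
  have n₁ := computable_codedNum.comp hv₁
  have d := computable_codedDen.comp hv
  have d₀ := computable_codedDen.comp hv₀
  have d₁ := computable_codedDen.comp hv₁
  exact (d.re_ne_zero.and (d₀.re_ne_zero.and d₁.re_ne_zero)).and
    ((((n₀.nat_mul d₁).nat_add (n₁.nat_mul d₀)).nat_mul d).re_eq (n.nat_mul (d₀.nat_mul d₁)))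

theorem re_splitsAt : REPred fun a : Code × List Bool => SplitsAt a.1 a.2 := by
  refine REPred.exists (REPred.exists (REPred.exists ?_))
  have hc : Computable fun a : (((Code × List Bool) × ℕ) × ℕ) × ℕ => a.1.1.1.1 :=
    Computable.fst.comp (Computable.fst.comp (Computable.fst.comp Computable.fst))
  have hy : Computable fun a : (((Code × List Bool) × ℕ) × ℕ) × ℕ => a.1.1.1.2 :=
    Computable.snd.comp (Computable.fst.comp (Computable.fst.comp Computable.fst))
  have hv : Computable fun a : (((Code × List Bool) × ℕ) × ℕ) × ℕ => a.1.1.2 :=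
    Computable.snd.comp (Computable.fst.comp Computable.fst)
  have hv₀ : Computable fun a : (((Code × List Bool) × ℕ) × ℕ) × ℕ => a.1.2 :=
    Computable.snd.comp Computable.fst
  have hv₁ : Computable fun a : (((Code × List Bool) × ℕ) × ℕ) × ℕ => a.2 := Computable.snd
  have hy₀ := Computable.list_concat.comp hy (Computable.const false)
  have hy₁ := Computable.list_concat.comp hy (Computable.const true)
  have h := hc.re_mem_eval hy hv
  have h₀ := hc.re_mem_eval hy₀ hv₀
  have h₁ := hc.re_mem_eval hy₁ hv₁
  have hadd := re_codedAdd.comp (hv.pair (hv₀.pair hv₁))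
  exact (h.and (h₀.and h₁)).and hadd

theorem re_validUpTo : REPred fun a : Code × List Bool => ValidUpTo a.1 a.2 := by
  refine REPred.and (REPred.exists (REPred.and ?_ ?_)) (REPred.forall_lt ?_ ?_)
  · exact (Computable.fst.comp Computable.fst).re_mem_eval (Computable.const []) Computable.snd
  · exact (computable_codedNum.comp Computable.snd).re_le
      (computable_codedDen.comp Computable.snd)
  · exact re_splitsAt.comp ((Computable.fst.comp Computable.fst).pair
      (Primrec.list_take.to_comp.comp Computable.snd (Computable.snd.comp Computable.fst)))
  · exact Computable.list_length.comp Computable.snd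

/-- The universal test: level `n` consists of the strings `x` to which some program, valid up to `x`
and having a description `p`, gives at least `2 ^ (n + p.length)` times the measure that the program
`cP` gives to `x`. -/
def universalTest (U : List Bool →. ℕ) (cP : Code) : Set (ℕ × List Bool) :=
  {a | ∃ (p : List Bool) (m v w : ℕ),
    (m ∈ U p ∧ ValidUpTo (Denumerable.ofNat Code m) a.2) ∧
    (v ∈ (Denumerable.ofNat Code m).eval (Encodable.encode a.2) ∧
      w ∈ cP.eval (Encodable.encode a.2)) ∧
    v.unpair.2 ≠ 0 ∧
    2 ^ (a.1 + p.length) * w.unpair.1 * v.unpair.2 ≤ v.unpair.1 * w.unpair.2}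

theorem re_universalTest {U : List Bool →. ℕ} (hU : Partrec U) (cP : Code) :
    REPred fun a : ℕ × List Bool => a ∈ universalTest U cP := by
  refine REPred.exists (REPred.exists (REPred.exists (REPred.exists ?_)))
  have hn : Computable fun a : ((((ℕ × List Bool) × List Bool) × ℕ) × ℕ) × ℕ => a.1.1.1.1.1 :=
    Computable.fst.comp (Computable.fst.comp (Computable.fst.comp
      (Computable.fst.comp Computable.fst)))
  have hx : Computable fun a : ((((ℕ × List Bool) × List Bool) × ℕ) × ℕ) × ℕ => a.1.1.1.1.2 :=
    Computable.snd.comp (Computable.fst.comp (Computable.fst.comp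
      (Computable.fst.comp Computable.fst)))
  have hp : Computable fun a : ((((ℕ × List Bool) × List Bool) × ℕ) × ℕ) × ℕ => a.1.1.1.2 :=
    Computable.snd.comp (Computable.fst.comp (Computable.fst.comp Computable.fst))
  have hm : Computable fun a : ((((ℕ × List Bool) × List Bool) × ℕ) × ℕ) × ℕ => a.1.1.2 :=
    Computable.snd.comp (Computable.fst.comp Computable.fst)
  have hv : Computable fun a : ((((ℕ × List Bool) × List Bool) × ℕ) × ℕ) × ℕ => a.1.2 :=
    Computable.snd.comp Computable.fst
  have hw : Computable fun a : ((((ℕ × List Bool) × List Bool) × ℕ) × ℕ) × ℕ => a.2 :=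
    Computable.snd
  have hc : Computable fun a : ((((ℕ × List Bool) × List Bool) × ℕ) × ℕ) × ℕ =>
      Denumerable.ofNat Code a.1.1.2 := (Primrec.ofNat Code).to_comp.comp hm
  exact (((Partrec.mem_re hU).comp (hp.pair hm)).and (re_validUpTo.comp (hc.pair hx))).and
    (((hc.re_mem_eval hx hv).and ((Computable.const cP).re_mem_eval hx hw)).and
      ((computable_codedDen.comp hv).re_ne_zero.and
        ((((Computable.const 2).nat_pow (hn.nat_add (Computable.list_length.comp hp))).nat_mul
          (computable_codedNum.comp hw)).nat_mul (computable_codedDen.comp hv)|>.re_le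
          ((computable_codedNum.comp hv).nat_mul (computable_codedDen.comp hw)))))

/-- Kraft's inequality for the domain of a prefix-free machine. -/
theorem IsPrefixMachine.tsum_le {U : List Bool →. ℕ} (hU : IsPrefixMachine U) :
    ∑' p : {p | (U p).Dom}, (2⁻¹ : ENNReal) ^ (p : List Bool).length ≤ 1 := by
  have hW : IsSuperadditive fun x => (2⁻¹ : ENNReal) ^ x.length := by
    intro x
    simp only [List.length_append, List.length_singleton, pow_succ]
    rw [← mul_add, ENNReal.inv_two_add_inv_two, mul_one]
  simpa using hW.tsum_le {p | (U p).Dom} fun p hp q hq => hU.prefixFree p q hp hq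

/-- The mixture of the valid outputs of all programs that have a `U`-description, a description `p`
having the weight `2 ^ (-p.length)`. -/
noncomputable def mixture (U : List Bool →. ℕ) (x : List Bool) : ENNReal :=
  ∑' p : {p | (U p).Dom}, (2⁻¹ : ENNReal) ^ (p : List Bool).length *
    validOutput (Denumerable.ofNat Code ((U p).get p.2)) x

theorem isSuperadditive_mixture (U : List Bool →. ℕ) : IsSuperadditive (mixture U) := by
  intro x
  unfold mixture
  rw [← ENNReal.tsum_add]
  refine ENNReal.tsum_le_tsum fun p => ?_
  rw [← mul_add]
  exact mul_le_mul_right (isSuperadditive_validOutput _ x) _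

theorem IsPrefixMachine.mixture_nil_le {U : List Bool →. ℕ} (hU : IsPrefixMachine U) :
    mixture U [] ≤ 1 := by
  refine (ENNReal.tsum_le_tsum fun p => ?_).trans hU.tsum_le
  exact mul_le_of_le_one_right zero_le (validOutput_nil_le _)

theorem isMartinLofTest_universalTest {U : List Bool →. ℕ} (hU : IsPrefixMachine U)
    {P : List Bool → ℚ} (hP : IsTreeMeasure P) {cP : Code} (hcP : Computes cP P) :
    IsMartinLofTest P (universalTest U cP) := by
  refine ⟨re_universalTest hU.partrec cP, fun n =>
    (isSuperadditive_mixture U).cantorMeasure_le hU.mixture_nil_le ?_⟩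
  rintro x ⟨p, m, v, w, ⟨hm, hvalid⟩, ⟨hv, hw⟩, hden, hle⟩
  have hdom : (U p).Dom := Part.dom_iff_mem.2 ⟨m, hm⟩
  have hget : (U p).get hdom = m := Part.get_eq_of_mem hm _
  have hPw : codedRat w = P x := by
    rw [Part.mem_unique hw (hcP.mem x), codedRat_pair (hP.nonneg x)]
  have hwden : w.unpair.2 ≠ 0 := by
    rw [Part.mem_unique hw (hcP.mem x), Nat.unpair_pair]
    exact Rat.den_nz _
  have hle' : 2 ^ (n + p.length) * P x ≤ codedRat v := by
    rw [← hPw, codedRat, codedRat, ← mul_div_assoc, div_le_div_iff₀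
      (by exact_mod_cast Nat.pos_of_ne_zero hwden) (by exact_mod_cast Nat.pos_of_ne_zero hden)]
    exact_mod_cast hle
  have hreal : (2 : ℝ) ^ (n + p.length) * (P x : ℝ) ≤ (codedRat v : ℝ) := by exact_mod_cast hle'
  have henn : 2 ^ (n + p.length) * ENNReal.ofReal (P x : ℝ) ≤ ENNReal.ofReal (codedRat v : ℝ) := by
    have := ENNReal.ofReal_le_ofReal hreal
    rwa [ENNReal.ofReal_mul (by positivity), ENNReal.ofReal_pow (by norm_num),
      ENNReal.ofReal_ofNat] at this
  calc 2 ^ n * ENNReal.ofReal (P x : ℝ)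
      = (2⁻¹ : ENNReal) ^ p.length * (2 ^ (n + p.length) * ENNReal.ofReal (P x : ℝ)) := by
        rw [add_comm n, pow_add, mul_assoc, ← mul_assoc _ (2 ^ p.length), ← mul_pow,
          ENNReal.inv_mul_cancel two_ne_zero ENNReal.ofNat_ne_top, one_pow, one_mul]
    _ ≤ (2⁻¹ : ENNReal) ^ p.length * ENNReal.ofReal (codedRat v : ℝ) := mul_le_mul_right henn _
    _ = (2⁻¹ : ENNReal) ^ p.length *
          validOutput (Denumerable.ofNat Code ((U p).get hdom)) x := by
        rw [hget, validOutput_of_mem hvalid hv]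
    _ ≤ mixture U x := ENNReal.le_tsum (f := fun p : {p | (U p).Dom} =>
        (2⁻¹ : ENNReal) ^ (p : List Bool).length *
          validOutput (Denumerable.ofNat Code ((U p).get p.2)) x) ⟨p, hdom⟩

/-- Along a random sequence, a measure `Q` with a description `p` exceeds `P` at most by a factor
proportional to `2 ^ p.length`, the constant being the same for all `Q`. -/
theorem IsMartinLofRandom.exists_lt {U : List Bool →. ℕ} (hU : IsPrefixMachine U)
    {P : List Bool → ℚ} (hP : IsComputableMeasure P) {ω : ℕ → Bool} (hω : IsMartinLofRandom P ω) :
    ∃ n : ℕ, ∀ (k : ℕ) (p : List Bool) (c : Code) (Q : List Bool → ℚ), IsTreeMeasure Q →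
      Computes c Q → Encodable.encode c ∈ U p →
      Q (seqPrefix ω k) < 2 ^ (n + p.length) * P (seqPrefix ω k) := by
  obtain ⟨cP, hcP⟩ := hP.exists_program
  have h := hω _ (isMartinLofTest_universalTest hU hP.isTreeMeasure hcP)
  rw [Set.mem_iInter, not_forall] at h
  obtain ⟨n, hn⟩ := h
  refine ⟨n, fun k p c Q hQ hc hp => ?_⟩
  by_contra! hle
  set x := seqPrefix ω k
  refine hn (mem_testLevel.2 ⟨k, p, _, Nat.pair (Q x).num.toNat (Q x).den, _,
    ⟨hp, ?_⟩, ⟨?_, hcP.mem x⟩, ?_, ?_⟩)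
  · rw [Denumerable.ofNat_encode]
    exact hc.validUpTo hQ x
  · rw [Denumerable.ofNat_encode]
    exact hc.mem x
  · rw [Nat.unpair_pair]
    exact Rat.den_nz _
  · simp only [Nat.unpair_pair]
    have e₁ := codedRat_pair (hQ.nonneg x)
    have e₂ := codedRat_pair (hP.isTreeMeasure.nonneg x)
    rw [← e₁, ← e₂, codedRat, codedRat, ← mul_div_assoc, div_le_div_iff₀
      (by simpa using Rat.den_pos _) (by simpa using Rat.den_pos _)] at hle
    simp only [Nat.unpair_pair] at hle
    exact_mod_cast hle

end programs

/-! ### Merging of two measures along a random sequence -/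

/-- The conditional probabilities of `P` and `Q` differ substantially at `x`: the absolute value on
the right-hand side is `P x * Q x` times their difference. Without the division the condition is
meaningful also if `P x` or `Q x` is `0`, and it never holds if both are. -/
def Disagree (P Q : List Bool → ℚ) (m : ℕ) (x : List Bool) : Prop :=
  (P x + Q x) ^ 2 < m * |Q (x ++ [false]) * P x - P (x ++ [false]) * Q x|

instance (P Q : List Bool → ℚ) (m : ℕ) : DecidablePred (Disagree P Q m) :=
  fun x => inferInstanceAs (Decidable ((P x + Q x) ^ 2 < _))

/-- The number of proper prefixes of `x` at which `P` and `Q` disagree. -/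
def disagreements (P Q : List Bool → ℚ) (m : ℕ) (x : List Bool) : ℕ :=
  Nat.count (fun i => Disagree P Q m (x.take i)) x.length

theorem disagreements_append (P Q : List Bool → ℚ) (m : ℕ) (x : List Bool) (b : Bool) :
    disagreements P Q m (x ++ [b]) =
      disagreements P Q m x + if Disagree P Q m x then 1 else 0 := by
  unfold disagreements
  rw [List.length_append, List.length_singleton, Nat.count_succ, List.take_left]
  congr 1
  simp only [Nat.count_eq_card_filter_range]
  congr 1
  refine Finset.filter_congr fun i hi => ?_
  rw [List.take_append_of_le_length (Finset.mem_range.1 hi).le]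

theorem disagreements_seqPrefix (P Q : List Bool → ℚ) (m : ℕ) (ω : ℕ → Bool) (k : ℕ) :
    disagreements P Q m (seqPrefix ω k) =
      Nat.count (fun i => Disagree P Q m (seqPrefix ω i)) k := by
  unfold disagreements
  rw [length_seqPrefix]
  simp only [Nat.count_eq_card_filter_range]
  congr 1
  refine Finset.filter_congr fun i hi => ?_
  rw [take_seqPrefix ω (Finset.mem_range.1 hi).le]

/-- The loss of the concave function `p * q / (p + q)` when the pair `(p, q)` is split in two. -/
theorem mul_div_add_split {p₀ p₁ q₀ q₁ : ℚ} (h₀ : 0 < p₀ + q₀) (h₁ : 0 < p₁ + q₁) :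
    p₀ * q₀ / (p₀ + q₀) + p₁ * q₁ / (p₁ + q₁)
      + (q₀ * p₁ - p₀ * q₁) ^ 2 / ((p₀ + q₀) * (p₁ + q₁) * (p₀ + p₁ + (q₀ + q₁))) =
    (p₀ + p₁) * (q₀ + q₁) / (p₀ + p₁ + (q₀ + q₁)) := by
  have h : p₀ + p₁ + (q₀ + q₁) ≠ 0 := by linarith
  have h₀' := h₀.ne'
  have h₁' := h₁.ne'
  field_simp
  ring

theorem mul_div_add_split_le {p₀ p₁ q₀ q₁ : ℚ} (hp₀ : 0 ≤ p₀) (hp₁ : 0 ≤ p₁) (hq₀ : 0 ≤ q₀)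
    (hq₁ : 0 ≤ q₁) (m : ℕ) :
    (if (p₀ + p₁ + (q₀ + q₁)) ^ 2 < m * |q₀ * (p₀ + p₁) - p₀ * (q₀ + q₁)| then
        p₀ + p₁ + (q₀ + q₁) else 0)
      + m ^ 2 * (p₀ * q₀ / (p₀ + q₀)) + m ^ 2 * (p₁ * q₁ / (p₁ + q₁)) ≤
    m ^ 2 * ((p₀ + p₁) * (q₀ + q₁) / (p₀ + p₁ + (q₀ + q₁))) := by
  have hD : q₀ * (p₀ + p₁) - p₀ * (q₀ + q₁) = q₀ * p₁ - p₀ * q₁ := by ring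
  rw [hD]
  rcases (add_nonneg hp₀ hq₀).eq_or_lt with h₀ | h₀
  · have hp : p₀ = 0 := by linarith
    have hq : q₀ = 0 := by linarith
    subst hp hq
    simp [not_lt.2 (sq_nonneg (p₁ + q₁))]
  rcases (add_nonneg hp₁ hq₁).eq_or_lt with h₁ | h₁
  · have hp : p₁ = 0 := by linarith
    have hq : q₁ = 0 := by linarith
    subst hp hq
    simp [not_lt.2 (sq_nonneg (p₀ + q₀))]
  rw [← mul_div_add_split h₀ h₁]
  set B₀ := p₀ + q₀
  set B₁ := p₁ + q₁
  have hB : p₀ + p₁ + (q₀ + q₁) = B₀ + B₁ := by ring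
  rw [hB]
  set D := q₀ * p₁ - p₀ * q₁
  have key : (if (B₀ + B₁) ^ 2 < m * |D| then B₀ + B₁ else 0)
      ≤ m ^ 2 * (D ^ 2 / (B₀ * B₁ * (B₀ + B₁))) := by
    split_ifs with hbad
    · rw [← mul_div_assoc, le_div_iff₀ (by positivity)]
      have h1 : ((B₀ + B₁) ^ 2) ^ 2 ≤ (m * |D|) ^ 2 :=
        pow_le_pow_left₀ (by positivity) hbad.le 2
      rw [mul_pow, sq_abs] at h1
      have h2 : B₀ * B₁ ≤ (B₀ + B₁) ^ 2 := by nlinarith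
      calc (B₀ + B₁) * (B₀ * B₁ * (B₀ + B₁)) = (B₀ + B₁) ^ 2 * (B₀ * B₁) := by ring
        _ ≤ (B₀ + B₁) ^ 2 * (B₀ + B₁) ^ 2 := by gcongr
        _ = ((B₀ + B₁) ^ 2) ^ 2 := by ring
        _ ≤ _ := h1
    · positivity
  linarith

/-- The weight that bounds the number of disagreements: every disagreement is paid for by a loss in
the term `P x * Q x / (P x + Q x)`. -/
def disagreementWeight (P Q : List Bool → ℚ) (m : ℕ) (x : List Bool) : ℚ :=
  disagreements P Q m x * (P x + Q x) + m ^ 2 * (P x * Q x / (P x + Q x))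

theorem disagreementWeight_split {P Q : List Bool → ℚ} (hP : IsTreeMeasure P)
    (hQ : IsTreeMeasure Q) (m : ℕ) (x : List Bool) :
    disagreementWeight P Q m (x ++ [false]) + disagreementWeight P Q m (x ++ [true]) ≤
      disagreementWeight P Q m x := by
  have h := mul_div_add_split_le (hP.nonneg (x ++ [false])) (hP.nonneg (x ++ [true]))
    (hQ.nonneg (x ++ [false])) (hQ.nonneg (x ++ [true])) m
  rw [hP.split, hQ.split] at h
  change (if Disagree P Q m x then P x + Q x else 0) + _ + _ ≤ _ at h
  unfold disagreementWeight
  rw [disagreements_append, disagreements_append]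
  have hP' := hP.split x
  have hQ' := hQ.split x
  have e : (P (x ++ [false]) + Q (x ++ [false])) + (P (x ++ [true]) + Q (x ++ [true])) =
      P x + Q x := by linarith
  by_cases hd : Disagree P Q m x
  · rw [if_pos hd] at h
    simp only [if_pos hd]
    push_cast
    linear_combination h + (disagreements P Q m x + 1 : ℚ) * e
  · rw [if_neg hd] at h
    simp only [if_neg hd]
    push_cast
    linear_combination h + (disagreements P Q m x : ℚ) * e

theorem disagreementWeight_nonneg {P Q : List Bool → ℚ} (hP : IsTreeMeasure P)
    (hQ : IsTreeMeasure Q) (m : ℕ) (x : List Bool) : 0 ≤ disagreementWeight P Q m x := by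
  have := hP.nonneg x
  have := hQ.nonneg x
  unfold disagreementWeight
  positivity

/-- The test against the strings with many disagreements of `P` and `Q`. -/
def disagreementTest (P Q : List Bool → ℚ) (m : ℕ) : Set (ℕ × List Bool) :=
  {a | m ^ 2 * 2 ^ a.1 ≤ disagreements P Q m a.2}

theorem Computes.computable {c : Nat.Partrec.Code} {P : List Bool → ℚ} (h : Computes c P) :
    Computable fun x => Nat.pair (P x).num.toNat (P x).den := by
  have hp : Partrec fun x : List Bool => c.eval (Encodable.encode x) :=
    Nat.Partrec.Code.eval_part.comp (Computable.const c) Computable.encode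
  exact hp.of_eq_tot h.mem

/-- Disagreement as an inequality between natural numbers, obtained by clearing denominators. The sum
of the two truncated subtractions, one of which vanishes, is an absolute value. -/
theorem disagree_iff {P Q : List Bool → ℚ} (hP : IsTreeMeasure P) (hQ : IsTreeMeasure Q)
    (m : ℕ) (x : List Bool) :
    let a₁ := (P x).num.toNat
    let b₁ := (P x).den
    let a₂ := (Q x).num.toNat
    let b₂ := (Q x).den
    let a₃ := (P (x ++ [false])).num.toNat
    let b₃ := (P (x ++ [false])).den
    let a₄ := (Q (x ++ [false])).num.toNat
    let b₄ := (Q (x ++ [false])).den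
    Disagree P Q m x ↔
      (a₁ * b₂ + a₂ * b₁) ^ 2 * (b₃ * b₄) <
        m * ((a₄ * a₁ * (b₁ * b₂ ^ 2 * b₃) - a₃ * a₂ * (b₁ ^ 2 * b₂ * b₄))
          + (a₃ * a₂ * (b₁ ^ 2 * b₂ * b₄) - a₄ * a₁ * (b₁ * b₂ ^ 2 * b₃))) := by
  intro a₁ b₁ a₂ b₂ a₃ b₃ a₄ b₄
  have hnum : ∀ q : ℚ, 0 ≤ q → ((q.num.toNat : ℕ) : ℚ) = q * q.den := fun q hq => by
    rw [Rat.mul_den_eq_num]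
    exact_mod_cast Int.toNat_of_nonneg (Rat.num_nonneg.2 hq)
  have h₁ : (a₁ : ℚ) = P x * b₁ := hnum _ (hP.nonneg _)
  have h₂ : (a₂ : ℚ) = Q x * b₂ := hnum _ (hQ.nonneg _)
  have h₃ : (a₃ : ℚ) = P (x ++ [false]) * b₃ := hnum _ (hP.nonneg _)
  have h₄ : (a₄ : ℚ) = Q (x ++ [false]) * b₄ := hnum _ (hQ.nonneg _)
  have habs : ∀ s t : ℕ, ((s - t + (t - s) : ℕ) : ℚ) = |(s : ℚ) - t| := by
    intro s t
    rcases le_total s t with h | h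
    · rw [Nat.sub_eq_zero_of_le h, zero_add, Nat.cast_sub h, abs_sub_comm,
        abs_of_nonneg (sub_nonneg.2 (by exact_mod_cast h))]
    · rw [Nat.sub_eq_zero_of_le h, add_zero, Nat.cast_sub h,
        abs_of_nonneg (sub_nonneg.2 (by exact_mod_cast h))]
  have hE : (0 : ℚ) < (b₁ : ℚ) ^ 2 * b₂ ^ 2 * (b₃ * b₄) := by
    have p₁ : (0 : ℚ) < b₁ := by exact_mod_cast (P x).den_pos
    have p₂ : (0 : ℚ) < b₂ := by exact_mod_cast (Q x).den_pos
    have p₃ : (0 : ℚ) < b₃ := by exact_mod_cast (P (x ++ [false])).den_pos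
    have p₄ : (0 : ℚ) < b₄ := by exact_mod_cast (Q (x ++ [false])).den_pos
    positivity
  rw [← Nat.cast_lt (α := ℚ), Nat.cast_mul m, habs]
  push_cast
  rw [h₁, h₂, h₃, h₄, Disagree, ← mul_lt_mul_iff_left₀ hE, mul_assoc (m : ℚ),
    ← abs_of_pos hE, ← abs_mul, abs_of_pos hE]
  ring_nf

theorem computable_disagree {P Q : List Bool → ℚ} (hP : IsComputableMeasure P)
    (hQ : IsComputableMeasure Q) (m : ℕ) :
    Computable fun x => decide (Disagree P Q m x) := by
  obtain ⟨c, hc⟩ := hP.exists_program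
  obtain ⟨d, hd⟩ := hQ.exists_program
  have hx : Computable fun x : List Bool => x ++ [false] :=
    Computable.list_concat.comp Computable.id (Computable.const false)
  have num : ∀ {R : List Bool → ℚ} {e : Nat.Partrec.Code}, Computes e R →
      Computable fun x => (R x).num.toNat := fun h =>
    (computable_codedNum.comp h.computable).of_eq fun x => by rw [Nat.unpair_pair]
  have den : ∀ {R : List Bool → ℚ} {e : Nat.Partrec.Code}, Computes e R →
      Computable fun x => (R x).den := fun h =>
    (computable_codedDen.comp h.computable).of_eq fun x => by rw [Nat.unpair_pair]
  have a₁ := num hc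
  have b₁ := den hc
  have a₂ := num hd
  have b₂ := den hd
  have a₃ := (num hc).comp hx
  have b₃ := (den hc).comp hx
  have a₄ := (num hd).comp hx
  have b₄ := (den hd).comp hx
  have two := Computable.const (α := List Bool) 2
  have s := (a₄.nat_mul a₁).nat_mul ((b₁.nat_mul (b₂.nat_pow two)).nat_mul b₃)
  have t := (a₃.nat_mul a₂).nat_mul (((b₁.nat_pow two).nat_mul b₂).nat_mul b₄)
  have rhs := (Computable.const m).nat_mul ((s.nat_sub t).nat_add (t.nat_sub s))
  have lhs := (((a₁.nat_mul b₂).nat_add (a₂.nat_mul b₁)).nat_pow two).nat_mul (b₃.nat_mul b₄)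
  have hlt := Primrec.nat_lt.decide.to_comp.comp lhs rhs
  refine hlt.of_eq fun x => ?_
  exact decide_eq_decide.2 (disagree_iff hP.isTreeMeasure hQ.isTreeMeasure m x).symm

theorem isMartinLofTest_disagreementTest {P Q : List Bool → ℚ} (hP : IsComputableMeasure P)
    (hQ : IsComputableMeasure Q) {m : ℕ} (hm : m ≠ 0) :
    IsMartinLofTest P (disagreementTest P Q m) := by
  constructor
  · have hN : Computable fun x => disagreements P Q m x :=
      Computable.nat_count ((computable_disagree hP hQ m).comp
        (Primrec.list_take.to_comp.comp Computable.snd Computable.fst)) Computable.list_length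
    have hl : Computable fun a : ℕ × List Bool => m ^ 2 * 2 ^ a.1 :=
      (Computable.const _).nat_mul ((Computable.const 2).nat_pow Computable.fst)
    exact hl.re_le (hN.comp Computable.snd)
  · intro n
    have hm' : (0 : ℚ) < (m : ℚ) ^ 2 := by positivity
    have hw : ∀ x, 0 ≤ disagreementWeight P Q m x / (m : ℚ) ^ 2 := fun x =>
      div_nonneg (disagreementWeight_nonneg hP.isTreeMeasure hQ.isTreeMeasure m x) hm'.le
    have hW : IsSuperadditive fun x =>
        ENNReal.ofReal ((disagreementWeight P Q m x / (m : ℚ) ^ 2 : ℚ) : ℝ) := by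
      intro x
      simp only
      rw [← ENNReal.ofReal_add (by exact_mod_cast hw _) (by exact_mod_cast hw _)]
      refine ENNReal.ofReal_le_ofReal ?_
      have := (div_le_div_iff_of_pos_right hm').2
        (disagreementWeight_split hP.isTreeMeasure hQ.isTreeMeasure m x)
      rw [add_div] at this
      exact_mod_cast this
    refine hW.cantorMeasure_le ?_ ?_
    · rw [ENNReal.ofReal_le_one]
      have : disagreementWeight P Q m [] / (m : ℚ) ^ 2 ≤ 1 := by
        rw [div_le_one hm']
        simp only [disagreementWeight, disagreements, hP.isTreeMeasure.root,
          hQ.isTreeMeasure.root, List.length_nil, Nat.count_zero]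
        norm_num
        linarith
      exact_mod_cast this
    · intro x hx
      have hP0 := hP.isTreeMeasure.nonneg x
      have hQ0 := hQ.isTreeMeasure.nonneg x
      have hx' : (m : ℚ) ^ 2 * 2 ^ n ≤ disagreements P Q m x := by exact_mod_cast hx
      have h : 2 ^ n * P x ≤ disagreementWeight P Q m x / (m : ℚ) ^ 2 := by
        rw [le_div_iff₀ hm']
        have h1 : (m : ℚ) ^ 2 * 2 ^ n * (P x + Q x) ≤ disagreements P Q m x * (P x + Q x) :=
          mul_le_mul_of_nonneg_right hx' (by positivity)
        have h2 : 0 ≤ (m : ℚ) ^ 2 * 2 ^ n * Q x := by positivity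
        have h3 : 0 ≤ (m : ℚ) ^ 2 * (P x * Q x / (P x + Q x)) := by positivity
        unfold disagreementWeight
        linarith
      have hreal : (2 : ℝ) ^ n * (P x : ℝ) ≤
          ((disagreementWeight P Q m x / (m : ℚ) ^ 2 : ℚ) : ℝ) := by exact_mod_cast h
      have := ENNReal.ofReal_le_ofReal hreal
      rwa [ENNReal.ofReal_mul (by positivity), ENNReal.ofReal_pow (by norm_num),
        ENNReal.ofReal_ofNat] at this

theorem IsMartinLofRandom.eventually_not_disagree {P Q : List Bool → ℚ}
    (hP : IsComputableMeasure P) (hQ : IsComputableMeasure Q) {ω : ℕ → Bool}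
    (hω : IsMartinLofRandom P ω) {m : ℕ} (hm : m ≠ 0) :
    ∀ᶠ k in atTop, ¬ Disagree P Q m (seqPrefix ω k) := by
  have h := hω _ (isMartinLofTest_disagreementTest hP hQ hm)
  rw [Set.mem_iInter, not_forall] at h
  obtain ⟨n, hn⟩ := h
  by_contra hfreq
  have hinf : {i | Disagree P Q m (seqPrefix ω i)}.Infinite := by
    rw [← Nat.frequently_atTop_iff_infinite]
    exact fun h => hfreq h
  refine hn (mem_testLevel.2
    ⟨Nat.nth (fun i => Disagree P Q m (seqPrefix ω i)) (m ^ 2 * 2 ^ n), ?_⟩)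
  change m ^ 2 * 2 ^ n ≤ disagreements P Q m (seqPrefix ω _)
  rw [disagreements_seqPrefix, Nat.count_nth_of_infinite hinf]

/-! ### Complexity of best explanations -/

section programs

open Nat.Partrec (Code)

theorem IsOptimalPrefixMachine.exists_description {U : List Bool →. ℕ}
    (hU : IsOptimalPrefixMachine U) (m : ℕ) : ∃ p, m ∈ U p := by
  -- Compare `U` with the machine whose only description, the empty string, describes `m`.
  let V : List Bool →. ℕ := fun p => ((if p = [] then some m else none : Option ℕ) : Part ℕ)
  have hdom : ∀ p, (V p).Dom → p = [] := by
    intro p hp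
    by_contra h
    simp [V, h] at hp
  have hV : IsPrefixMachine V := by
    refine ⟨?_, fun p q hp hq _ => by rw [hdom p hp, hdom q hq]⟩
    have h : Primrec fun p : List Bool => if p = [] then some m else none :=
      Primrec.ite (Primrec.eq.comp Primrec.id (Primrec.const [])) (Primrec.const _)
        (Primrec.const _)
    exact Computable.ofOption h.to_comp
  obtain ⟨d, hd⟩ := hU.optimal V hV
  obtain ⟨q, hq, -⟩ := hd [] m (by simp [V])
  exact ⟨q, hq⟩

theorem IsOptimalPrefixMachine.exists_shortest {U : List Bool →. ℕ}
    (hU : IsOptimalPrefixMachine U) {Q : List Bool → ℚ} (hQ : IsComputableMeasure Q) :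
    ∃ (p : List Bool) (c : Code), Computes c Q ∧ Encodable.encode c ∈ U p ∧
      p.length = measureComplexity U Q := by
  obtain ⟨c, hc⟩ := hQ.exists_program
  obtain ⟨p, hp⟩ := hU.exists_description (Encodable.encode c)
  exact Nat.sInf_mem (s := {k | ∃ (p : List Bool) (c : Code),
    Computes c Q ∧ Encodable.encode c ∈ U p ∧ p.length = k}) ⟨_, p, c, hc, hp, rfl⟩

theorem Computes.unique {c : Code} {Q R : List Bool → ℚ} (hQ : Computes c Q) (hR : Computes c R)
    (hQ' : IsTreeMeasure Q) (hR' : IsTreeMeasure R) : Q = R := by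
  funext x
  rw [← codedRat_pair (hQ'.nonneg x), ← codedRat_pair (hR'.nonneg x),
    Part.mem_unique (hQ.mem x) (hR.mem x)]

theorem IsOptimalPrefixMachine.finite_setOf_complexity_le {U : List Bool →. ℕ}
    (hU : IsOptimalPrefixMachine U) (k : ℕ) :
    {Q | IsComputableMeasure Q ∧ measureComplexity U Q ≤ k}.Finite := by
  have hfin : (⋃ p ∈ {p : List Bool | p.length ≤ k}, {Q | IsTreeMeasure Q ∧
      ∃ c : Code, Computes c Q ∧ Encodable.encode c ∈ U p}).Finite := by
    refine (List.finite_length_le Bool k).biUnion fun p _ => Set.Subsingleton.finite ?_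
    rintro Q ⟨hQ, c, hc, hcp⟩ R ⟨hR, d, hd, hdp⟩
    have hcd : c = d := Encodable.encode_injective (Part.mem_unique hcp hdp)
    exact hc.unique (hcd ▸ hd) hQ hR
  refine hfin.subset ?_
  rintro Q ⟨hQ, hk⟩
  obtain ⟨p, c, hc, hp, hlen⟩ := hU.exists_shortest hQ
  exact Set.mem_biUnion (x := p) (show p.length ≤ k from hlen ▸ hk) ⟨hQ.isTreeMeasure, c, hc, hp⟩

/-- The defining inequality of a best explanation, with the logarithms removed. -/
theorem IsBestExplanation.pos_and_le {U : List Bool →. ℕ} {x : List Bool} {P Q : List Bool → ℚ}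
    (hQ : IsBestExplanation U x Q) (hP : IsComputableMeasure P) (hPx : 0 < P x) :
    0 < Q x ∧ 2 ^ (3 * measureComplexity U Q) * P x ≤ 2 ^ (3 * measureComplexity U P) * Q x := by
  have h := hQ.minimal P hP
  rw [explanationCost, explanationCost, if_neg hPx.ne'] at h
  have hQx : Q x ≠ 0 := by
    intro h0
    rw [if_pos h0, top_le_iff] at h
    exact EReal.coe_ne_top _ h
  rw [if_neg hQx, EReal.coe_le_coe_iff] at h
  have hQpos : 0 < Q x := lt_of_le_of_ne (hQ.isComputableMeasure.isTreeMeasure.nonneg x) hQx.symm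
  refine ⟨hQpos, ?_⟩
  have hP' : (0 : ℝ) < (P x : ℝ) := by exact_mod_cast hPx
  have hQ' : (0 : ℝ) < (Q x : ℝ) := by exact_mod_cast hQpos
  have key : (2 : ℝ) ^ (3 * measureComplexity U Q) * (P x : ℝ) ≤
      2 ^ (3 * measureComplexity U P) * (Q x : ℝ) := by
    rw [← Real.logb_le_logb one_lt_two (by positivity) (by positivity),
      Real.logb_mul (by positivity) hP'.ne', Real.logb_mul (by positivity) hQ'.ne',
      Real.logb_pow, Real.logb_pow, Real.logb_self_eq_one one_lt_two]
    push_cast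
    linarith
  exact_mod_cast key

end programs

/-! ### Convergence of the predictions -/

theorem abs_condProb_sub_le {P Q : List Bool → ℚ} {x : List Bool} {m : ℕ} (hm : m ≠ 0) {C : ℚ}
    (hP : 0 < P x) (hQ : 0 < Q x) (h : ¬ Disagree P Q m x)
    (hC : (P x + Q x) ^ 2 ≤ C * (P x * Q x)) :
    |condProb Q false x - condProb P false x| ≤ C / m := by
  have hm' : (0 : ℚ) < m := by exact_mod_cast Nat.pos_of_ne_zero hm
  have h' := (not_lt.1 h).trans hC
  have hPQ : 0 < P x * Q x := mul_pos hP hQ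
  rw [condProb, condProb, div_sub_div _ _ hQ.ne' hP.ne', abs_div, abs_of_pos (mul_pos hQ hP),
    div_le_div_iff₀ (mul_pos hQ hP) hm', mul_comm (Q x) (P (x ++ [false])), mul_comm (Q x) (P x)]
  linarith

theorem theorem4
    (U : List Bool →. ℕ) (hU : IsOptimalPrefixMachine U)
    (best : List Bool → List Bool → ℚ) (hbest : ∀ x, IsBestExplanation U x (best x))
    (P : List Bool → ℚ) (hP : IsComputableMeasure P)
    (ω : ℕ → Bool) (hω : IsMartinLofRandom P ω) :
    (∀ n, 0 < P (seqPrefix ω n) ∧ 0 < best (seqPrefix ω n) (seqPrefix ω n)) ∧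
    Tendsto (fun n : ℕ => ((bestPrediction best false (seqPrefix ω n) : ℚ) : ℝ) -
      ((condProb P false (seqPrefix ω n) : ℚ) : ℝ)) atTop (𝓝 0) := by
  obtain ⟨n, hn⟩ := hω.exists_lt hU.isPrefixMachine hP
  have hPpos : ∀ k, 0 < P (seqPrefix ω k) := by
    intro k
    obtain ⟨p, c, hc, hp, -⟩ := hU.exists_shortest hP
    have h := hn k p c P hP.isTreeMeasure hc hp
    refine lt_of_le_of_ne (hP.isTreeMeasure.nonneg _) fun h0 => ?_
    rw [← h0, mul_zero] at h
    exact h.false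
  have hb := fun k => (hbest (seqPrefix ω k)).pos_and_le hP (hPpos k)
  refine ⟨fun k => ⟨hPpos k, (hb k).1⟩, ?_⟩
  set K := measureComplexity U P
  -- The lower bound `2 ^ (3 K(Q) - 3 K(P)) ≤ Q x / P x` for the best explanation `Q` meets the
  -- upper bound `Q x / P x < 2 ^ (n + K(Q))` that comes from randomness.
  have hupper : ∀ k, best (seqPrefix ω k) (seqPrefix ω k) <
      2 ^ (n + measureComplexity U (best (seqPrefix ω k))) * P (seqPrefix ω k) := by
    intro k
    have hcm := (hbest (seqPrefix ω k)).isComputableMeasure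
    obtain ⟨p, c, hc, hp, hlen⟩ := hU.exists_shortest hcm
    exact hlen ▸ hn k p c _ hcm.isTreeMeasure hc hp
  have hK : ∀ k, measureComplexity U (best (seqPrefix ω k)) ≤ n + 3 * K := by
    intro k
    set KQ := measureComplexity U (best (seqPrefix ω k))
    have h : (2 : ℚ) ^ (3 * KQ) * P (seqPrefix ω k) <
        2 ^ (3 * K + (n + KQ)) * P (seqPrefix ω k) := by
      rw [pow_add, mul_assoc]
      exact (hb k).2.trans_lt (mul_lt_mul_of_pos_left (hupper k) (by positivity))
    have h' := lt_of_mul_lt_mul_right h (hPpos k).le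
    have := (pow_lt_pow_iff_right₀ (one_lt_two (α := ℚ))).1 h'
    omega
  let C : ℚ := 2 ^ (3 * K) + 2 ^ (n + (n + 3 * K)) + 2
  have hC : ∀ k, (P (seqPrefix ω k) + best (seqPrefix ω k) (seqPrefix ω k)) ^ 2 ≤
      C * (P (seqPrefix ω k) * best (seqPrefix ω k) (seqPrefix ω k)) := by
    intro k
    have hp := hPpos k
    have hq := (hb k).1
    have h₁ : P (seqPrefix ω k) ≤ 2 ^ (3 * K) * best (seqPrefix ω k) (seqPrefix ω k) :=
      (le_mul_of_one_le_left hp.le (one_le_pow₀ one_le_two)).trans (hb k).2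
    have h₂ : best (seqPrefix ω k) (seqPrefix ω k) ≤
        2 ^ (n + (n + 3 * K)) * P (seqPrefix ω k) := by
      refine (hupper k).le.trans (mul_le_mul_of_nonneg_right ?_ hp.le)
      exact pow_le_pow_right₀ one_le_two (Nat.add_le_add_left (hK k) n)
    have h₃ := mul_le_mul_of_nonneg_left h₁ hp.le
    have h₄ := mul_le_mul_of_nonneg_left h₂ hq.le
    simp only [C]
    linarith
  have hCpos : 0 < C := by positivity
  rw [Metric.tendsto_atTop']
  intro ε hε
  obtain ⟨m, hm⟩ := exists_nat_gt ((C : ℝ) / ε)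
  have hCpos' : (0 : ℝ) < C := by exact_mod_cast hCpos
  have hm0 : (0 : ℝ) < m := (div_pos hCpos' hε).trans hm
  have hm1 : m ≠ 0 := by
    rintro rfl
    simp at hm0
  -- Only finitely many measures occur as best explanations, so the convergence is uniform in them.
  have hev := (Filter.eventually_all_finite (l := atTop)
    (hU.finite_setOf_complexity_le (n + 3 * K))
    (p := fun Q k => ¬ Disagree P Q m (seqPrefix ω k))).2
    fun Q hQ => hω.eventually_not_disagree hP hQ.1 hm1
  obtain ⟨N, hN⟩ := eventually_atTop.1 hev
  refine ⟨N, fun k hk => ?_⟩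
  have h := abs_condProb_sub_le hm1 (hPpos k) (hb k).1
    (hN k hk.le _ ⟨(hbest _).isComputableMeasure, hK k⟩) (hC k)
  rw [Real.dist_eq, sub_zero, bestPrediction]
  have h' : |((condProb (best (seqPrefix ω k)) false (seqPrefix ω k) : ℚ) : ℝ) -
      ((condProb P false (seqPrefix ω k) : ℚ) : ℝ)| ≤ (C : ℝ) / m := by exact_mod_cast h
  refine h'.trans_lt ?_
  rw [div_lt_iff₀ hm0]
  rwa [div_lt_iff₀ hε, mul_comm] at hm
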